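/- There is an absolute constant $\Omega>0$ with the following property. Let $\nu$ be a Borel probability measure on $\mathbb{R}^d$, let $f:\mathbb{R}^d\to\mathbb{R}$ be positive and differentiable at $\nu$-almost every point, and put $H=\int(\nabla\log f)(\nabla\log f)^T\,\mathrm{d}\nu$. For a real random variable $\xi$ let $\|\xi\|_{\psi_2}=\sup_{k\geq 1}k^{-1/2}\,\mathbb{E}(|\xi|^k)^{1/k}$ (supremum over integers $k\ge 1$). Assume that, for some $L\geq 0$ and $X\sim\nu$, $$\|u^T\nabla\log f(X)\|_{\psi_2}\leq L\sqrt{u^THu}\qquad\text{for all }u\in\mathbb{R}^d .$$ Let $\Gamma\in\mathbb{R}^{d\times d}$ be symmetric positive definite and, for matrices $P,M\in\mathbb{R}^{d\times d}$, write $\mathcal{R}_\Gamma(P,M)=\mathrm{trace}\big(\Gamma^{-1}(I_d-P^T)M(I_d-P)\big)$. Let $0<\delta,\eta<1$, let $K\geq 1$ be an integer with $$K\geq\Omega\,\delta^{-2}L^4\Big(\sqrt{\mathrm{rank}(H)}+\sqrt{\log(2\eta^{-1})}\Big)^2,$$ let $X_1,\dots,X_K$ be independent random vectors with law $\nu$,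 and let $\widehat H=\frac1K\sum_{i=1}^K\nabla\log f(X_i)\,\nabla\log f(X_i)^T$. Then, with probability at least $1-\eta$, the relation $$(1-\delta)\,\mathcal{R}_\Gamma(P_r,H)\leq\mathcal{R}_\Gamma(P_r,\widehat H)\leq(1+\delta)\,\mathcal{R}_\Gamma(P_r,H)$$ holds simultaneously for all projectors $P_r\in\mathbb{R}^{d\times d}$ (all matrices with $P_r^2=P_r$, of any rank). -/

import Mathlib

open MeasureTheory ProbabilityTheory
open scoped ENNReal Matrix

noncomputable section

/-- The sub-Gaussian norm `‖ξ‖_{ψ₂} = sup_{k ≥ 1} k^{-1/2} E(|ξ|^k)^{1/k}` of a real random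
variable, as an extended nonnegative number (the supremum runs over the integers `k ≥ 1`; it is
finite only if all the moments are). -/
def subGaussianNorm {S : Type*} [MeasurableSpace S] (ξ : S → ℝ) (P : Measure S) : ℝ≥0∞ :=
  ⨆ (k : ℕ) (_ : 1 ≤ k), eLpNorm ξ (k : ℝ≥0∞) P / ENNReal.ofReal (√(k : ℝ))

/-- The score `∇ log f (x)`, as a coordinate vector. -/
def score {d : ℕ} (f : EuclideanSpace ℝ (Fin d) → ℝ) (x : EuclideanSpace ℝ (Fin d)) :
    Fin d → ℝ :=
  (gradient (fun y => Real.log (f y)) x).ofLp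

/-- The matrix `H = ∫ (∇ log f) (∇ log f)ᵀ dν`. -/
def scoreMatrix {d : ℕ} (f : EuclideanSpace ℝ (Fin d) → ℝ)
    (ν : Measure (EuclideanSpace ℝ (Fin d))) : Matrix (Fin d) (Fin d) ℝ :=
  Matrix.of fun i j => ∫ x, score f x i * score f x j ∂ν

/-- The Monte Carlo matrix `(1/K) ∑ i, (∇ log f (x i)) (∇ log f (x i))ᵀ` of `K` sample points. -/
def monteCarloMatrix {d K : ℕ} (f : EuclideanSpace ℝ (Fin d) → ℝ)
    (x : Fin K → EuclideanSpace ℝ (Fin d)) : Matrix (Fin d) (Fin d) ℝ :=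
  (1 / (K : ℝ)) • ∑ i, Matrix.vecMulVec (score f (x i)) (score f (x i))

/-- The reconstruction error `R_Γ(P, H) = trace (Γ⁻¹ (I - Pᵀ) H (I - P))`. -/
def reconstructionError {d : ℕ} (Γ P H : Matrix (Fin d) (Fin d) ℝ) : ℝ :=
  (Γ⁻¹ * (1 - Pᵀ) * H * (1 - P)).trace

end

/-!
The reconstruction error `R_Γ(P, M)` is a sum of values `wᵀ M w` of the quadratic form of `M`, at
vectors `w` that depend on `Γ` and `P` only (`exists_reconstructionError_eq_sum`). It therefore
suffices to prove, with high probability, the relative bound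
`|uᵀ Ĥ u - uᵀ H u| ≤ δ uᵀ H u` for all vectors `u` at once; the bounds for all `P` follow.

For a fixed `u`, the sub-Gaussian hypothesis bounds the moments of the squares `(uᵀ ∇ log f)²` by
those of an exponential variable of scale `L² uᵀ H u`, and a Bernstein inequality
(`measure_lt_abs_sum_sub_one_le`) gives a tail of the form `2 exp (- c K ε² / L⁴)`; the first moment
forces `L²` to be bounded below, so that only the Gaussian regime of the inequality matters.

To pass to all `u`, write `H = Bᵀ B`. On the range of `B`, whose dimension is the rank of `H`, the
quadratic form of `H` becomes the squared norm, and a net of at most `5 ^ rank H` points of a sphere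
controls every symmetric form up to a factor `32` (`abs_quadratic_le_of_net`). The directions that
`B` annihilates are annihilated by `Ĥ` almost surely (`ae_monteCarloMatrix_mulVec_eq_zero`). A union
bound over the net (`exists_finset_test_directions`, `union_bound_le`) concludes.
-/

/-! ### Moments and exponential tails -/

theorem moment_le_of_subGaussianNorm_le {S : Type*} [MeasurableSpace S] {P : Measure S}
    {ξ : S → ℝ} (hξ : AEStronglyMeasurable ξ P) {M : ℝ} (hM : 0 ≤ M)
    (h : subGaussianNorm ξ P ≤ ENNReal.ofReal M) {k : ℕ} (hk : 1 ≤ k) :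
    MemLp ξ k P ∧ ∫ x, |ξ x| ^ k ∂P ≤ (M * √k) ^ k := by
  have hk0 : (0 : ℝ) < √(k : ℝ) := Real.sqrt_pos.2 (by exact_mod_cast hk)
  have h1 : eLpNorm ξ (k : ℝ≥0∞) P / ENNReal.ofReal (√(k : ℝ)) ≤ ENNReal.ofReal M :=
    (le_iSup₂ (f := fun (k : ℕ) (_ : 1 ≤ k) =>
      eLpNorm ξ (k : ℝ≥0∞) P / ENNReal.ofReal (√(k : ℝ))) k hk).trans h
  have h2 : eLpNorm ξ (k : ℝ≥0∞) P ≤ ENNReal.ofReal (M * √k) := by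
    rw [ENNReal.ofReal_mul hM]
    rwa [ENNReal.div_le_iff (by simpa using hk0) ENNReal.ofReal_ne_top] at h1
  have hmem : MemLp ξ k P := ⟨hξ, h2.trans_lt ENNReal.ofReal_lt_top⟩
  refine ⟨hmem, ?_⟩
  have hk' : (k : ℝ≥0∞) ≠ 0 := by exact_mod_cast (by omega : k ≠ 0)
  rw [hmem.eLpNorm_eq_integral_rpow_norm hk' (ENNReal.natCast_ne_top k),
    ENNReal.ofReal_le_ofReal_iff (by positivity)] at h2
  simp only [ENNReal.toReal_natCast, Real.norm_eq_abs, Real.rpow_natCast] at h2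
  have h0 : 0 ≤ ∫ x, |ξ x| ^ k ∂P := integral_nonneg fun x => by positivity
  calc ∫ x, |ξ x| ^ k ∂P = ((∫ x, |ξ x| ^ k ∂P) ^ ((k : ℝ)⁻¹)) ^ k := by
        rw [Real.rpow_inv_natCast_pow h0 (by omega)]
    _ ≤ (M * √k) ^ k := by gcongr

/-- The factor `k!` needed for a subexponential tail comes from `k ^ k ≤ e ^ k * k!`. -/
theorem sq_moment_le_of_subGaussianNorm_le {S : Type*} [MeasurableSpace S] {P : Measure S}
    [IsProbabilityMeasure P]
    {ξ : S → ℝ} (hξ : AEStronglyMeasurable ξ P) {M : ℝ} (hM : 0 ≤ M)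
    (h : subGaussianNorm ξ P ≤ ENNReal.ofReal M) (k : ℕ) :
    Integrable (fun x => (ξ x ^ 2) ^ k) P ∧
      ∫ x, (ξ x ^ 2) ^ k ∂P ≤ (2 * Real.exp 1 * M ^ 2) ^ k * k.factorial := by
  rcases Nat.eq_zero_or_pos k with rfl | hk
  · simp
  obtain ⟨hmem, hint⟩ := moment_le_of_subGaussianNorm_le hξ hM h (k := 2 * k) (by omega)
  have hfun : ∀ x, (ξ x ^ 2) ^ k = |ξ x| ^ (2 * k) := fun x => by
    rw [pow_mul, sq_abs]
  simp only [hfun]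
  refine ⟨by simpa using hmem.integrable_norm_pow (by omega), hint.trans ?_⟩
  have hs : (M * √((2 * k : ℕ) : ℝ)) ^ (2 * k) = (2 * M ^ 2) ^ k * (k : ℝ) ^ k := by
    rw [pow_mul, mul_pow, Real.sq_sqrt (by positivity), ← mul_pow]
    push_cast; ring
  rw [hs]
  have hf : (k : ℝ) ^ k ≤ Real.exp 1 ^ k * k.factorial := by
    have := Real.pow_div_factorial_le_exp (x := (k : ℝ)) (by positivity) k
    rwa [div_le_iff₀ (by positivity), ← mul_one (k : ℝ), Real.exp_nat_mul, mul_one] at this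
  calc (2 * M ^ 2) ^ k * (k : ℝ) ^ k ≤ (2 * M ^ 2) ^ k * (Real.exp 1 ^ k * k.factorial) := by
        gcongr
    _ = _ := by rw [mul_right_comm 2, mul_pow (2 * M ^ 2)]; ring

/-- The exponential series is integrated term by term; its terms of order at least two are bounded
by a geometric series. -/
theorem mgf_sub_one_le {S : Type*} [MeasurableSpace S] {P : Measure S} [IsProbabilityMeasure P]
    {Y : S → ℝ} {a : ℝ} (hYm : AEMeasurable Y P) (hY0 : ∀ x, 0 ≤ Y x)
    (hint : ∀ k : ℕ, Integrable (fun x => Y x ^ k) P)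
    (hmom : ∀ k : ℕ, ∫ x, Y x ^ k ∂P ≤ a ^ k * k.factorial) (h1 : ∫ x, Y x ∂P = 1)
    {t : ℝ} (ht : |t| * a ≤ 1 / 2) :
    Integrable (fun x => Real.exp (t * (Y x - 1))) P ∧
      mgf (fun x => Y x - 1) P t ≤ Real.exp (2 * a ^ 2 * t ^ 2) := by
  have ha : 0 < a := by
    have := hmom 1
    simp only [pow_one, Nat.factorial_one, Nat.cast_one, mul_one, h1] at this
    linarith
  set b := |t| * a with hb
  have hb0 : 0 ≤ b := by positivity
  have hgeo : Summable fun k : ℕ => b ^ k := summable_geometric_of_lt_one hb0 (by linarith)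
  have hterm : ∀ (s : ℝ), |s| = |t| → ∀ k : ℕ,
      ∫ x, ‖(s * Y x) ^ k / k.factorial‖ ∂P ≤ b ^ k := by
    intro s hs k
    have : ∀ x, ‖(s * Y x) ^ k / k.factorial‖ = |t| ^ k / k.factorial * Y x ^ k := by
      intro x
      rw [norm_div, norm_pow, norm_mul, Real.norm_eq_abs, Real.norm_eq_abs, hs,
        abs_of_nonneg (hY0 x), Real.norm_natCast, mul_pow]
      ring
    simp only [this]
    rw [integral_const_mul]
    calc |t| ^ k / k.factorial * ∫ x, Y x ^ k ∂P
        ≤ |t| ^ k / k.factorial * (a ^ k * k.factorial) := by gcongr; exact hmom k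
      _ = b ^ k := by rw [hb, mul_pow]; field_simp
  have hF : ∀ (s : ℝ) (k : ℕ), Integrable (fun x => (s * Y x) ^ k / k.factorial) P := by
    intro s k
    simp only [mul_pow]
    exact ((hint k).const_mul _).div_const _
  have hsum : ∀ (s : ℝ), |s| = |t| → Summable fun k : ℕ =>
      ∫ x, ‖(s * Y x) ^ k / k.factorial‖ ∂P := fun s hs =>
    Summable.of_nonneg_of_le (fun k => integral_nonneg fun x => norm_nonneg _) (hterm s hs) hgeo
  have hexp : ∀ x, ∑' k : ℕ, (t * Y x) ^ k / k.factorial = Real.exp (t * Y x) := fun x => by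
    rw [Real.exp_eq_exp_ℝ, NormedSpace.exp_eq_tsum_div]
  have hHS := hasSum_integral_of_summable_integral_norm (hF t) (hsum t rfl)
  simp only [hexp] at hHS
  have hI : Integrable (fun x => Real.exp (t * Y x)) P := by
    refine ⟨by fun_prop, ?_⟩
    have hle : ∫⁻ x, ‖Real.exp (t * Y x)‖ₑ ∂P
        ≤ ∑' k : ℕ, ∫⁻ x, ‖(t * Y x) ^ k / k.factorial‖ₑ ∂P := by
      rw [← lintegral_tsum fun k => ((hF t k).1.enorm)]
      refine lintegral_mono fun x => ?_
      rw [← hexp x]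
      exact enorm_tsum_le_tsum_enorm
    refine hle.trans_lt ?_
    have : ∀ k : ℕ, ∫⁻ x, ‖(t * Y x) ^ k / k.factorial‖ₑ ∂P
        = ENNReal.ofReal (∫ x, ‖(t * Y x) ^ k / k.factorial‖ ∂P) := fun k =>
      (ofReal_integral_norm_eq_lintegral_enorm (hF t k)).symm
    simp only [this]
    rw [← ENNReal.ofReal_tsum_of_nonneg (fun k => integral_nonneg fun x => norm_nonneg _)
      (hsum t rfl)]
    exact ENNReal.ofReal_lt_top
  have hsplit : ∀ x, Real.exp (t * (Y x - 1)) = Real.exp (-t) * Real.exp (t * Y x) := fun x => by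
    rw [← Real.exp_add]; ring_nf
  have hmain : ∫ x, Real.exp (t * Y x) ∂P ≤ 1 + t + 2 * b ^ 2 := by
    rw [← hHS.tsum_eq, hHS.summable.tsum_eq_zero_add,
      ((summable_nat_add_iff 1).2 hHS.summable).tsum_eq_zero_add]
    have e0 : ∫ x, (t * Y x) ^ 0 / (Nat.factorial 0 : ℝ) ∂P = 1 := by simp
    have e1 : ∫ x, (t * Y x) ^ (0 + 1) / (Nat.factorial (0 + 1) : ℝ) ∂P = t := by
      simp [integral_const_mul, h1]
    rw [e0, e1, ← add_assoc]
    gcongr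
    have hs2 : Summable fun k : ℕ => b ^ 2 * b ^ k := hgeo.mul_left _
    have hle : ∑' k : ℕ, ∫ x, (t * Y x) ^ (k + 1 + 1) / (Nat.factorial (k + 1 + 1) : ℝ) ∂P
        ≤ ∑' k : ℕ, b ^ 2 * b ^ k := by
      refine Summable.tsum_le_tsum (fun k => ?_)
        ((summable_nat_add_iff (f := fun k : ℕ =>
          ∫ x, (t * Y x) ^ k / (Nat.factorial k : ℝ) ∂P) 2).2 hHS.summable) hs2
      rw [← pow_add, add_comm 2 k]
      exact ((Real.le_norm_self _).trans (norm_integral_le_integral_norm _)).trans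
        (hterm t rfl (k + 2))
    refine hle.trans ?_
    rw [tsum_mul_left, tsum_geometric_of_lt_one hb0 (by linarith), mul_comm]
    gcongr
    rw [inv_le_comm₀ (by linarith) (by norm_num)]
    linarith
  refine ⟨by simpa only [hsplit] using hI.const_mul _, ?_⟩
  rw [mgf]
  simp only [hsplit]
  rw [integral_const_mul]
  calc Real.exp (-t) * ∫ x, Real.exp (t * Y x) ∂P
      ≤ Real.exp (-t) * Real.exp (t + 2 * b ^ 2) := by
        gcongr
        refine hmain.trans ?_
        have := Real.add_one_le_exp (t + 2 * b ^ 2)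
        linarith
    _ = Real.exp (2 * a ^ 2 * t ^ 2) := by
        rw [← Real.exp_add, hb, mul_pow, sq_abs]; ring_nf

/-- A Bernstein inequality. The choice `t = ± ε / (4 a²)` minimizes the Chernoff exponent
`- t ε + 2 a² t²`; the condition `ε ≤ 2 a` keeps it in the range of `mgf_sub_one_le`. -/
theorem measure_lt_abs_sum_sub_one_le {Ω : Type*} [MeasurableSpace Ω] {Q : Measure Ω}
    [IsProbabilityMeasure Q] {K : ℕ} {Y : Fin K → Ω → ℝ} {a ε : ℝ} (ha : 0 < a)
    (hε0 : 0 < ε) (hε : ε ≤ 2 * a) (hYm : ∀ i, AEMeasurable (Y i) Q) (hind : iIndepFun Y Q)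
    (hY0 : ∀ i ω, 0 ≤ Y i ω) (hint : ∀ i (k : ℕ), Integrable (fun ω => Y i ω ^ k) Q)
    (hmom : ∀ i (k : ℕ), ∫ ω, Y i ω ^ k ∂Q ≤ a ^ k * k.factorial)
    (h1 : ∀ i, ∫ ω, Y i ω ∂Q = 1) :
    Q.real {ω | K * ε < |∑ i, (Y i ω - 1)|} ≤ 2 * Real.exp (-(K * ε ^ 2 / (8 * a ^ 2))) := by
  set t : ℝ := ε / (4 * a ^ 2) with ht
  have ht0 : 0 ≤ t := by positivity
  have hta : t * a ≤ 1 / 2 := by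
    rw [ht, div_mul_eq_mul_div, div_le_iff₀ (by positivity)]
    nlinarith
  have hindZ : iIndepFun (fun i ω => Y i ω - 1) Q :=
    hind.comp (fun _ y => y - 1) fun _ => by fun_prop
  have hZm : ∀ i, AEMeasurable (fun ω => Y i ω - 1) Q := fun i => (hYm i).sub_const 1
  have key : ∀ s : ℝ, |s| = t →
      Integrable (fun ω => Real.exp (s * ∑ i, (Y i ω - 1))) Q ∧
        mgf (fun ω => ∑ i, (Y i ω - 1)) Q s ≤ Real.exp (K * (2 * a ^ 2 * t ^ 2)) := by
    intro s hs
    have hi := fun i => mgf_sub_one_le (t := s) (hYm i) (hY0 i) (hint i) (hmom i) (h1 i)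
      (by rwa [hs])
    have hst : s ^ 2 = t ^ 2 := by rw [← hs, sq_abs]
    have hmgf : mgf (fun ω => ∑ i, (Y i ω - 1)) Q s = ∏ i, mgf (fun ω => Y i ω - 1) Q s := by
      rw [← hindZ.mgf_sum₀ hZm]
      congr 1
      ext ω
      simp
    constructor
    · -- A non-integrable exponential would have `mgf` equal to zero, but the product is positive.
      by_contra hcon
      have h0 : mgf (fun ω => ∑ i, (Y i ω - 1)) Q s = 0 := integral_undef hcon
      rw [hmgf] at h0
      exact (Finset.prod_pos fun i _ => mgf_pos (hi i).1).ne' h0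
    · rw [hmgf]
      calc ∏ i, mgf (fun ω => Y i ω - 1) Q s
          ≤ ∏ _i : Fin K, Real.exp (2 * a ^ 2 * t ^ 2) := by
            refine Finset.prod_le_prod (fun i _ => mgf_nonneg) fun i _ => ?_
            rw [← hst]; exact (hi i).2
        _ = Real.exp (K * (2 * a ^ 2 * t ^ 2)) := by
            rw [Finset.prod_const, Finset.card_univ, Fintype.card_fin, ← Real.exp_nat_mul]
  have hexp : Real.exp (-t * (K * ε)) * Real.exp (K * (2 * a ^ 2 * t ^ 2))
      = Real.exp (-(K * ε ^ 2 / (8 * a ^ 2))) := by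
    rw [← Real.exp_add, ht]
    congr 1
    field_simp
    ring
  obtain ⟨hip, hmp⟩ := key t (abs_of_nonneg ht0)
  obtain ⟨him, hmm⟩ := key (-t) (by rw [abs_neg, abs_of_nonneg ht0])
  have hup : Q.real {ω | K * ε ≤ ∑ i, (Y i ω - 1)} ≤ Real.exp (-(K * ε ^ 2 / (8 * a ^ 2))) := by
    rw [← hexp]
    exact (measure_ge_le_exp_mul_mgf _ ht0 hip).trans (by gcongr)
  have hlo : Q.real {ω | ∑ i, (Y i ω - 1) ≤ -(K * ε)}
      ≤ Real.exp (-(K * ε ^ 2 / (8 * a ^ 2))) := by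
    rw [← hexp]
    refine (measure_le_le_exp_mul_mgf _ (by linarith : -t ≤ 0) him).trans ?_
    rw [show - -t * -(K * ε) = -t * (K * ε) by ring]
    gcongr
  calc Q.real {ω | K * ε < |∑ i, (Y i ω - 1)|}
      ≤ Q.real ({ω | K * ε ≤ ∑ i, (Y i ω - 1)} ∪ {ω | ∑ i, (Y i ω - 1) ≤ -(K * ε)}) := by
        refine measureReal_mono fun ω hω => ?_
        rcases lt_abs.1 (Set.mem_ofPred.1 hω) with h | h
        · exact Or.inl h.le
        · exact Or.inr (by simp only [Set.mem_ofPred_eq]; linarith)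
    _ ≤ _ := (measureReal_union_le _ _).trans (by linarith)

/-! ### Quadratic forms and nets of the sphere -/

/-- A maximal `1`-separated subset of the sphere of radius `2`; its cardinality is controlled by
volume. -/
theorem exists_sphere_net (V : Type*) [NormedAddCommGroup V] [NormedSpace ℝ V]
    [FiniteDimensional ℝ V] :
    ∃ N : Finset V, N.card ≤ 5 ^ Module.finrank ℝ V ∧ (∀ y ∈ N, ‖y‖ = 2) ∧
      ∀ x : V, ‖x‖ = 2 → ∃ y ∈ N, ‖x - y‖ ≤ 1 := by
  classical
  let good : Finset V → Prop := fun N =>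
    (∀ y ∈ N, ‖y‖ = 2) ∧ ∀ c ∈ N, ∀ d ∈ N, c ≠ d → 1 ≤ ‖c - d‖
  have hcard : ∀ N, good N → N.card ≤ 5 ^ Module.finrank ℝ V := fun N hN =>
    Besicovitch.card_le_of_separated N (fun c hc => (hN.1 c hc).le) hN.2
  let p : ℕ → Prop := fun n => ∃ N, good N ∧ N.card = n
  have hp0 : p 0 := ⟨∅, ⟨by simp, by simp⟩, rfl⟩
  obtain ⟨N, hN, hNc⟩ : p (Nat.findGreatest p (5 ^ Module.finrank ℝ V)) :=
    Nat.findGreatest_spec (Nat.zero_le _) hp0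
  refine ⟨N, hcard N hN, hN.1, fun x hx => ?_⟩
  by_contra! hfar
  have hxN : x ∉ N := fun h => absurd (hfar x h) (by simp)
  have hgood : good (insert x N) := by
    refine ⟨fun y hy => ?_, fun c hc d hd hcd => ?_⟩
    · rcases Finset.mem_insert.1 hy with rfl | hy
      exacts [hx, hN.1 y hy]
    · rw [Finset.mem_insert] at hc hd
      rcases hc with hc | hc <;> rcases hd with hd | hd
      · exact absurd (hc.trans hd.symm) hcd
      · rw [hc]; exact (hfar d hd).le
      · rw [hd, norm_sub_rev]; exact (hfar c hc).le
      · exact hN.2 c hc d hd hcd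
  have := Nat.le_findGreatest (P := p) (hcard _ hgood) ⟨_, hgood, rfl⟩
  rw [Finset.card_insert_of_notMem hxN] at this
  omega

/-- Discretization of the norm of a symmetric bilinear form. With `m` the maximum of
`|b x x| / ‖x‖²`, `b x x - b y y = b (x - y) (x + y)` is at most
`m * (‖2 (x - y)‖² + ‖(x + y) / 2‖²) / 2`, and `‖x - y‖² + ‖x + y‖²` is fixed by the parallelogram
law; a net with mesh half the radius is therefore fine enough. -/
theorem abs_quadratic_le_of_net {V : Type*} [NormedAddCommGroup V] [InnerProductSpace ℝ V]
    [FiniteDimensional ℝ V] (b : V →ₗ[ℝ] V →ₗ[ℝ] ℝ) (hb : ∀ x y, b x y = b y x)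
    (N : Finset V) (hN2 : ∀ y ∈ N, ‖y‖ = 2) (hN : ∀ x : V, ‖x‖ = 2 → ∃ y ∈ N, ‖x - y‖ ≤ 1)
    {ε : ℝ} (h : ∀ y ∈ N, |b y y| ≤ ε * ‖y‖ ^ 2) (v : V) :
    |b v v| ≤ 32 * ε * ‖v‖ ^ 2 := by
  rcases eq_or_ne v 0 with rfl | hv
  · simp
  have hscale : ∀ w : V, w ≠ 0 → ‖(2 * ‖w‖⁻¹) • w‖ = 2 := fun w hw => by
    rw [norm_smul, Real.norm_of_nonneg (by positivity), mul_assoc,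
      inv_mul_cancel₀ (norm_ne_zero_iff.2 hw), mul_one]
  have hcont : Continuous fun x : V => |b x x| := by
    let B : V →L[ℝ] V →L[ℝ] ℝ :=
      LinearMap.toContinuousLinearMap (LinearMap.toContinuousLinearMap.toLinearMap ∘ₗ b)
    have : Continuous fun x : V => |B x x| := by fun_prop
    exact this
  obtain ⟨x, hx, hmax⟩ := (isCompact_sphere (0 : V) 2).exists_isMaxOn
    ⟨_, mem_sphere_zero_iff_norm.2 (hscale v hv)⟩ hcont.continuousOn
  rw [mem_sphere_zero_iff_norm] at hx
  set m := |b x x| with hm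
  have hm0 : 0 ≤ m := abs_nonneg _
  have hall : ∀ w : V, |b w w| ≤ m / 4 * ‖w‖ ^ 2 := by
    intro w
    rcases eq_or_ne w 0 with rfl | hw
    · simp
    have h1 : |b ((2 * ‖w‖⁻¹) • w) ((2 * ‖w‖⁻¹) • w)| ≤ m :=
      hmax (mem_sphere_zero_iff_norm.2 (hscale w hw))
    simp only [map_smul, LinearMap.smul_apply, smul_eq_mul, abs_mul] at h1
    have hw0 : 0 < ‖w‖ := norm_pos_iff.2 hw
    rw [abs_of_nonneg (by positivity : (0 : ℝ) ≤ 2), abs_of_pos (inv_pos.2 hw0)] at h1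
    have : |b w w| = (2 * ‖w‖⁻¹ * (2 * ‖w‖⁻¹ * |b w w|)) / 4 * ‖w‖ ^ 2 := by
      field_simp; ring
    rw [this]
    gcongr
  obtain ⟨y, hyN, hxy⟩ := hN x hx
  have hy := hN2 y hyN
  have hpar := parallelogram_law_with_norm ℝ x y
  have hdiff : |b x x - b y y| ≤ 31 / 32 * m := by
    have hid : b x x - b y y
        = (b ((2 : ℝ) • (x - y) + (1 / 2 : ℝ) • (x + y)) ((2 : ℝ) • (x - y) + (1 / 2 : ℝ) • (x + y))
          - b ((2 : ℝ) • (x - y) - (1 / 2 : ℝ) • (x + y))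
              ((2 : ℝ) • (x - y) - (1 / 2 : ℝ) • (x + y))) / 4 := by
      simp only [map_add, map_sub, map_smul, LinearMap.add_apply, LinearMap.sub_apply,
        LinearMap.smul_apply, smul_eq_mul, hb y x]
      ring
    have hpar2 := parallelogram_law_with_norm ℝ ((2 : ℝ) • (x - y)) ((1 / 2 : ℝ) • (x + y))
    rw [norm_smul, norm_smul, Real.norm_of_nonneg (by norm_num : (0 : ℝ) ≤ 2),
      Real.norm_of_nonneg (by norm_num : (0 : ℝ) ≤ 1 / 2)] at hpar2
    have hA := hall ((2 : ℝ) • (x - y) + (1 / 2 : ℝ) • (x + y))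
    have hB := hall ((2 : ℝ) • (x - y) - (1 / 2 : ℝ) • (x + y))
    have hd : ‖x - y‖ * ‖x - y‖ ≤ 1 := by nlinarith [norm_nonneg (x - y)]
    have hs : ‖(2 : ℝ) • (x - y) + (1 / 2 : ℝ) • (x + y)‖ ^ 2
        + ‖(2 : ℝ) • (x - y) - (1 / 2 : ℝ) • (x + y)‖ ^ 2 ≤ 31 / 2 := by
      rw [hx, hy] at hpar
      nlinarith
    rw [hid, abs_div, abs_of_pos (by norm_num : (0 : ℝ) < 4)]
    have := (abs_sub (b ((2 : ℝ) • (x - y) + (1 / 2 : ℝ) • (x + y))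
      ((2 : ℝ) • (x - y) + (1 / 2 : ℝ) • (x + y)))
      (b ((2 : ℝ) • (x - y) - (1 / 2 : ℝ) • (x + y)) ((2 : ℝ) • (x - y) - (1 / 2 : ℝ) • (x + y))))
    nlinarith
  have hyb := h y hyN
  rw [hy] at hyb
  have hm32 : m ≤ 128 * ε := by
    have : m - |b y y| ≤ |b x x - b y y| := abs_sub_abs_le_abs_sub _ _
    linarith
  calc |b v v| ≤ m / 4 * ‖v‖ ^ 2 := hall v
    _ ≤ 32 * ε * ‖v‖ ^ 2 := by gcongr; linarith

/-! ### Reduction to finitely many directions -/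

open scoped MatrixOrder in
theorem exists_eq_transpose_mul_self {d : ℕ} {M : Matrix (Fin d) (Fin d) ℝ} (hM : M.PosSemidef) :
    ∃ B : Matrix (Fin d) (Fin d) ℝ, M = Bᵀ * B := by
  obtain ⟨B, hB⟩ := CStarAlgebra.nonneg_iff_eq_star_mul_self.mp hM.nonneg
  exact ⟨B, by simpa [Matrix.star_eq_conjTranspose] using hB⟩

/-- The comparison of a symmetric matrix `A` with a positive semidefinite `H` can be tested on a
finite set `Z` of null directions of `H` and a set `N` of at most `5 ^ rank H` other directions.
With `H = Bᵀ * B`, the directions in `N` lift a net of a sphere of the range of `B`, where the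
quadratic form of `H` is the squared norm. -/
theorem exists_finset_test_directions {d : ℕ} {H : Matrix (Fin d) (Fin d) ℝ}
    (hH : H.PosSemidef) :
    ∃ N Z : Finset (Fin d → ℝ), N.card ≤ 5 ^ H.rank ∧ (∀ u ∈ N, 0 < u ⬝ᵥ (H *ᵥ u)) ∧
      (∀ z ∈ Z, z ⬝ᵥ (H *ᵥ z) = 0) ∧
      ∀ (A : Matrix (Fin d) (Fin d) ℝ), Aᵀ = A → (∀ z ∈ Z, A *ᵥ z = 0) → ∀ ε : ℝ,
        (∀ u ∈ N, |u ⬝ᵥ (A *ᵥ u) - u ⬝ᵥ (H *ᵥ u)| ≤ ε * (u ⬝ᵥ (H *ᵥ u))) →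
        ∀ u, |u ⬝ᵥ (A *ᵥ u) - u ⬝ᵥ (H *ᵥ u)| ≤ 32 * ε * (u ⬝ᵥ (H *ᵥ u)) := by
  classical
  obtain ⟨B, rfl⟩ := exists_eq_transpose_mul_self hH
  let T : (Fin d → ℝ) →ₗ[ℝ] EuclideanSpace ℝ (Fin d) :=
    (WithLp.linearEquiv 2 ℝ (Fin d → ℝ)).symm.toLinearMap ∘ₗ B.mulVecLin
  have hT : ∀ u, ‖T u‖ ^ 2 = u ⬝ᵥ ((Bᵀ * B) *ᵥ u) := by
    intro u
    rw [← Matrix.mulVec_mulVec, Matrix.dotProduct_mulVec, Matrix.vecMul_transpose,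
      EuclideanSpace.real_norm_sq_eq]
    simp [T, dotProduct, sq]
  have hrank : Module.finrank ℝ (LinearMap.range T) = (Bᵀ * B).rank := by
    rw [Matrix.rank_transpose_mul_self, Matrix.rank, LinearMap.range_comp]
    exact LinearEquiv.finrank_map_eq _ _
  obtain ⟨g, hg⟩ := T.rangeRestrict.exists_rightInverse_of_surjective T.range_rangeRestrict
  have hTg : ∀ v : LinearMap.range T, T (g v) = v := fun v => by
    have := congrArg Subtype.val (LinearMap.congr_fun hg v)
    simpa using this
  have hgn : ∀ v : LinearMap.range T, g v ⬝ᵥ ((Bᵀ * B) *ᵥ g v) = ‖v‖ ^ 2 := fun v => by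
    rw [← hT, hTg, Submodule.coe_norm]
  obtain ⟨N, hNc, hN2, hN⟩ := exists_sphere_net (LinearMap.range T)
  let π : (Fin d → ℝ) →ₗ[ℝ] (Fin d → ℝ) := LinearMap.id - g ∘ₗ T.rangeRestrict
  have hπ : ∀ u, T (π u) = 0 := fun u => by
    simp [π, hTg]
  refine ⟨N.image g, Finset.univ.image fun j => π (Pi.single j 1),
    Finset.card_image_le.trans (hrank ▸ hNc), ?_, ?_, ?_⟩
  · intro u hu
    obtain ⟨v, hv, rfl⟩ := Finset.mem_image.1 hu
    rw [hgn, hN2 v hv]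
    norm_num
  · intro z hz
    obtain ⟨j, -, rfl⟩ := Finset.mem_image.1 hz
    rw [← hT, hπ]
    simp
  intro A hA hZ ε hε u
  have hAπ : ∀ u, A *ᵥ π u = 0 := by
    have : A.mulVecLin ∘ₗ π = 0 := by
      refine LinearMap.pi_ext' fun j => LinearMap.ext_ring ?_
      simpa using hZ _ (Finset.mem_image_of_mem _ (Finset.mem_univ j))
    exact fun u => LinearMap.congr_fun this u
  have hsymm : ∀ (M : Matrix (Fin d) (Fin d) ℝ), Mᵀ = M → ∀ x y : Fin d → ℝ,
      x ⬝ᵥ (M *ᵥ y) = y ⬝ᵥ (M *ᵥ x) := fun M hM x y => by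
    rw [Matrix.dotProduct_mulVec, dotProduct_comm, ← Matrix.mulVec_transpose, hM]
  set v := T.rangeRestrict u with hv
  have hu : u = g v + π u := by simp [π, hv]
  have hAu : u ⬝ᵥ (A *ᵥ u) = g v ⬝ᵥ (A *ᵥ g v) := by
    have h1 : A *ᵥ u = A *ᵥ g v := by
      conv_lhs => rw [hu, Matrix.mulVec_add, hAπ, add_zero]
    rw [h1, hsymm A hA, h1]
  have hHu : u ⬝ᵥ ((Bᵀ * B) *ᵥ u) = ‖v‖ ^ 2 := by
    rw [← hT]; rfl
  have hMt : (A - Bᵀ * B)ᵀ = A - Bᵀ * B := by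
    rw [Matrix.transpose_sub, hA, Matrix.transpose_mul, Matrix.transpose_transpose]
  let b : LinearMap.range T →ₗ[ℝ] LinearMap.range T →ₗ[ℝ] ℝ :=
    (Matrix.toLinearMap₂' ℝ (A - Bᵀ * B)).compl₁₂ g g
  have hb : ∀ x y, b x y = g x ⬝ᵥ ((A - Bᵀ * B) *ᵥ g y) := fun x y => by
    simp only [b, LinearMap.compl₁₂_apply, Matrix.toLinearMap₂'_apply']
  have hbb : ∀ x, b x x = g x ⬝ᵥ (A *ᵥ g x) - ‖x‖ ^ 2 := fun x => by
    rw [hb, Matrix.sub_mulVec, dotProduct_sub, hgn]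
  have := abs_quadratic_le_of_net b (fun x y => by rw [hb, hb, hsymm _ hMt]) N hN2 hN (ε := ε)
    (fun y hy => by
      have := hε (g y) (Finset.mem_image_of_mem g hy)
      rwa [hgn, ← hbb] at this) v
  rwa [hAu, hHu, ← hbb]

/-- The reconstruction error is a sum of values of the quadratic form of the matrix, since
`Γ⁻¹ = C * Cᵀ`; in particular it is monotone in the matrix. -/
theorem exists_reconstructionError_eq_sum {d : ℕ} {Γ : Matrix (Fin d) (Fin d) ℝ} (hΓ : Γ.PosDef)
    (P : Matrix (Fin d) (Fin d) ℝ) :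
    ∃ w : Fin d → Fin d → ℝ, ∀ M : Matrix (Fin d) (Fin d) ℝ,
      reconstructionError Γ P M = ∑ j, w j ⬝ᵥ (M *ᵥ w j) := by
  obtain ⟨B, hB⟩ := exists_eq_transpose_mul_self hΓ.posSemidef.inv
  refine ⟨fun j => ((1 - P) * Bᵀ).col j, fun M => ?_⟩
  have h : Γ⁻¹ * (1 - Pᵀ) * M * (1 - P) = Bᵀ * (B * (1 - Pᵀ) * M * (1 - P)) := by
    rw [hB]; simp only [Matrix.mul_assoc]
  rw [reconstructionError, h, Matrix.trace_mul_comm, Matrix.trace]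
  refine Finset.sum_congr rfl fun j _ => ?_
  have h2 : B * (1 - Pᵀ) * M * (1 - P) * Bᵀ = ((1 - P) * Bᵀ)ᵀ * (M * ((1 - P) * Bᵀ)) := by
    rw [Matrix.transpose_mul, Matrix.transpose_sub, Matrix.transpose_one,
      Matrix.transpose_transpose]
    simp only [Matrix.mul_assoc]
  rw [h2]
  rfl

theorem reconstructionError_bounds_of_abs_le {d : ℕ} {Γ H A : Matrix (Fin d) (Fin d) ℝ}
    (hΓ : Γ.PosDef) {δ : ℝ}
    (h : ∀ u, |u ⬝ᵥ (A *ᵥ u) - u ⬝ᵥ (H *ᵥ u)| ≤ δ * (u ⬝ᵥ (H *ᵥ u)))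
    (P : Matrix (Fin d) (Fin d) ℝ) :
    (1 - δ) * reconstructionError Γ P H ≤ reconstructionError Γ P A ∧
      reconstructionError Γ P A ≤ (1 + δ) * reconstructionError Γ P H := by
  obtain ⟨w, hw⟩ := exists_reconstructionError_eq_sum hΓ P
  rw [hw, hw, Finset.mul_sum, Finset.mul_sum]
  constructor <;> refine Finset.sum_le_sum fun j _ => ?_ <;>
    have := abs_le.1 (h (w j)) <;> linarith

/-! ### The score and its second moments -/

/-- No regularity of `f` is needed: the derivative of an arbitrary function is Borel measurable. -/
theorem measurable_dotProduct_score {d : ℕ} (f : EuclideanSpace ℝ (Fin d) → ℝ) (u : Fin d → ℝ) :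
    Measurable fun x => u ⬝ᵥ score f x := by
  have hgrad : Measurable (gradient fun y => Real.log (f y)) :=
    (InnerProductSpace.toDual ℝ (EuclideanSpace ℝ (Fin d))).symm.continuous.measurable.comp
      (measurable_fderiv ℝ _)
  have hs : ∀ i, Measurable fun x => score f x i := fun i =>
    (EuclideanSpace.proj (𝕜 := ℝ) i).continuous.measurable.comp hgrad
  unfold dotProduct
  fun_prop

theorem dotProduct_scoreMatrix_mulVec {d : ℕ} {f : EuclideanSpace ℝ (Fin d) → ℝ}
    {ν : Measure (EuclideanSpace ℝ (Fin d))}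
    (h2 : ∀ u : Fin d → ℝ, MemLp (fun x => u ⬝ᵥ score f x) 2 ν) (u : Fin d → ℝ) :
    u ⬝ᵥ (scoreMatrix f ν *ᵥ u) = ∫ x, (u ⬝ᵥ score f x) ^ 2 ∂ν := by
  have hs : ∀ i, MemLp (fun x => score f x i) 2 ν := fun i => by
    simpa using h2 (Pi.single i 1)
  have hij : ∀ i j, Integrable (fun x => u i * (score f x i * score f x j * u j)) ν :=
    fun i j => (((hs i).integrable_mul (hs j)).mul_const _).const_mul _
  have hexp : ∀ x, (u ⬝ᵥ score f x) ^ 2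
      = ∑ i, ∑ j, u i * (score f x i * score f x j * u j) := fun x => by
    rw [sq, dotProduct, Finset.sum_mul_sum]
    refine Finset.sum_congr rfl fun i _ => Finset.sum_congr rfl fun j _ => by ring
  simp only [hexp]
  rw [integral_finsetSum _ fun i _ => integrable_finsetSum _ fun j _ => hij i j]
  simp only [dotProduct, Matrix.mulVec, scoreMatrix, Matrix.of_apply, Finset.mul_sum]
  refine Finset.sum_congr rfl fun i _ => ?_
  rw [integral_finsetSum _ fun j _ => hij i j]
  refine Finset.sum_congr rfl fun j _ => ?_
  rw [integral_const_mul, integral_mul_const]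

theorem scoreMatrix_posSemidef {d : ℕ} {f : EuclideanSpace ℝ (Fin d) → ℝ}
    {ν : Measure (EuclideanSpace ℝ (Fin d))}
    (h2 : ∀ u : Fin d → ℝ, MemLp (fun x => u ⬝ᵥ score f x) 2 ν) :
    (scoreMatrix f ν).PosSemidef := by
  refine Matrix.PosSemidef.of_dotProduct_mulVec_nonneg ?_ fun u => ?_
  · ext i j
    simp [scoreMatrix, mul_comm]
  · rw [star_trivial, dotProduct_scoreMatrix_mulVec h2]
    exact integral_nonneg fun x => sq_nonneg _

theorem monteCarloMatrix_mulVec {d K : ℕ} (f : EuclideanSpace ℝ (Fin d) → ℝ)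
    (x : Fin K → EuclideanSpace ℝ (Fin d)) (u : Fin d → ℝ) :
    monteCarloMatrix f x *ᵥ u = (1 / (K : ℝ)) • ∑ i, (u ⬝ᵥ score f (x i)) • score f (x i) := by
  rw [monteCarloMatrix, Matrix.smul_mulVec, Matrix.sum_mulVec]
  simp only [Matrix.vecMulVec_mulVec, op_smul_eq_smul, dotProduct_comm u]

theorem dotProduct_monteCarloMatrix_mulVec {d K : ℕ} (f : EuclideanSpace ℝ (Fin d) → ℝ)
    (x : Fin K → EuclideanSpace ℝ (Fin d)) (u : Fin d → ℝ) :
    u ⬝ᵥ (monteCarloMatrix f x *ᵥ u) = (1 / (K : ℝ)) * ∑ i, (u ⬝ᵥ score f (x i)) ^ 2 := by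
  rw [monteCarloMatrix_mulVec, dotProduct_smul, dotProduct_sum]
  simp only [dotProduct_smul, smul_eq_mul, sq]

theorem monteCarloMatrix_transpose {d K : ℕ} (f : EuclideanSpace ℝ (Fin d) → ℝ)
    (x : Fin K → EuclideanSpace ℝ (Fin d)) :
    (monteCarloMatrix f x)ᵀ = monteCarloMatrix f x := by
  simp [monteCarloMatrix, Matrix.transpose_sum, Matrix.transpose_vecMulVec]

/-! ### Concentration of the Monte Carlo matrix -/

/-- The random matrix vanishes almost surely on the null directions of its mean, which lets the
rank of the mean replace the ambient dimension. -/
theorem ae_monteCarloMatrix_mulVec_eq_zero {d K : ℕ} {f : EuclideanSpace ℝ (Fin d) → ℝ}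
    {ν : Measure (EuclideanSpace ℝ (Fin d))}
    (h2 : ∀ u : Fin d → ℝ, MemLp (fun x => u ⬝ᵥ score f x) 2 ν)
    {S : Type*} [MeasurableSpace S] {Q : Measure S}
    {X : Fin K → S → EuclideanSpace ℝ (Fin d)} (hlaw : ∀ i, HasLaw (X i) ν Q)
    {z : Fin d → ℝ} (hz : z ⬝ᵥ (scoreMatrix f ν *ᵥ z) = 0) :
    ∀ᵐ ω ∂Q, monteCarloMatrix f (fun i => X i ω) *ᵥ z = 0 := by
  rw [dotProduct_scoreMatrix_mulVec h2,
    integral_eq_zero_iff_of_nonneg (fun x => sq_nonneg _) (h2 z).integrable_sq] at hz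
  have hi : ∀ i, ∀ᵐ ω ∂Q, z ⬝ᵥ score f (X i ω) = 0 := fun i => by
    rw [← (hlaw i).map_eq] at hz
    filter_upwards [ae_of_ae_map (hlaw i).aemeasurable hz] with ω hω
    simpa using hω
  filter_upwards [ae_all_iff.2 hi] with ω hω
  simp [monteCarloMatrix_mulVec, hω]

/-- Concentration in one direction `u`. The normalized squares `(u ⬝ᵥ score f x) ^ 2 / (uᵀ H u)`
have mean one and `k`-th moment at most `(2 e L²) ^ k * k!`. -/
theorem measure_lt_abs_monteCarloMatrix_sub_le {d K : ℕ} {f : EuclideanSpace ℝ (Fin d) → ℝ}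
    {ν : Measure (EuclideanSpace ℝ (Fin d))} [IsProbabilityMeasure ν] {L : ℝ}
    (hL : 0 ≤ L)
    (hsub : ∀ u : Fin d → ℝ, subGaussianNorm (fun x => u ⬝ᵥ score f x) ν
      ≤ ENNReal.ofReal (L * √(u ⬝ᵥ (scoreMatrix f ν *ᵥ u))))
    (h2 : ∀ u : Fin d → ℝ, MemLp (fun x => u ⬝ᵥ score f x) 2 ν)
    (hK : 1 ≤ K) {S : Type*} [MeasurableSpace S] {Q : Measure S} [IsProbabilityMeasure Q]
    {X : Fin K → S → EuclideanSpace ℝ (Fin d)} (hlaw : ∀ i, HasLaw (X i) ν Q)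
    (hindep : iIndepFun X Q) {u : Fin d → ℝ} (hu : 0 < u ⬝ᵥ (scoreMatrix f ν *ᵥ u))
    {ε : ℝ} (hε0 : 0 < ε) (hε1 : ε ≤ 1) :
    0 < L ∧ Q.real {ω | ε * (u ⬝ᵥ (scoreMatrix f ν *ᵥ u))
        < |u ⬝ᵥ (monteCarloMatrix f (fun i => X i ω) *ᵥ u) - u ⬝ᵥ (scoreMatrix f ν *ᵥ u)|}
      ≤ 2 * Real.exp (-(K * ε ^ 2 / (8 * (2 * Real.exp 1 * L ^ 2) ^ 2))) := by
  set q := u ⬝ᵥ (scoreMatrix f ν *ᵥ u) with hq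
  set a := 2 * Real.exp 1 * L ^ 2 with ha
  set y : EuclideanSpace ℝ (Fin d) → ℝ := fun x => (u ⬝ᵥ score f x) ^ 2 / q with hy
  have hmeas := measurable_dotProduct_score f u
  have hym : Measurable y := (hmeas.pow_const 2).div_const q
  have hmom := sq_moment_le_of_subGaussianNorm_le (P := ν) hmeas.aestronglyMeasurable
    (by positivity) (hsub u)
  have hyint : ∀ k : ℕ, Integrable (fun x => y x ^ k) ν := fun k => by
    simp only [hy, div_pow]
    exact (hmom k).1.div_const _
  have hymom : ∀ k : ℕ, ∫ x, y x ^ k ∂ν ≤ a ^ k * k.factorial := fun k => by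
    simp only [hy, div_pow]
    rw [integral_div, div_le_iff₀ (by positivity)]
    refine (hmom k).2.trans (le_of_eq ?_)
    rw [mul_pow L, Real.sq_sqrt hu.le, ← mul_assoc, mul_pow _ q, ← ha]
    ring
  have hy1 : ∫ x, y x ∂ν = 1 := by
    simp only [hy]
    rw [integral_div, ← dotProduct_scoreMatrix_mulVec h2, ← hq, div_self hu.ne']
  -- The first moment gives a lower bound on the sub-Gaussian constant.
  have ha1 : 1 ≤ a := by simpa [hy1] using hymom 1
  have hL0 : 0 < L := by
    refine hL.lt_of_ne fun h => ?_
    rw [ha, ← h] at ha1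
    norm_num at ha1
  refine ⟨hL0, ?_⟩
  have htr : ∀ (i : Fin K) (g : EuclideanSpace ℝ (Fin d) → ℝ), Measurable g →
      ∫ ω, g (X i ω) ∂Q = ∫ x, g x ∂ν := fun i g hg =>
    (hlaw i).integral_comp hg.aestronglyMeasurable
  have hK0 : (0 : ℝ) < K := by exact_mod_cast hK
  have hB := measure_lt_abs_sum_sub_one_le (Q := Q) (Y := fun i ω => y (X i ω)) (a := a) (ε := ε)
    (by linarith) hε0 (by linarith) (fun i => hym.comp_aemeasurable (hlaw i).aemeasurable)
    (hindep.comp (fun _ => y) fun _ => hym) (fun i ω => by simp only [hy]; positivity)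
    (fun i k => by
      have := hyint k
      rw [← (hlaw i).map_eq] at this
      exact this.comp_aemeasurable (hlaw i).aemeasurable)
    (fun i k => (htr i _ (hym.pow_const k)).trans_le (hymom k))
    (fun i => (htr i _ hym).trans hy1)
  refine le_trans (measureReal_mono fun ω hω => ?_) hB
  rw [Set.mem_ofPred] at hω ⊢
  rw [dotProduct_monteCarloMatrix_mulVec] at hω
  have hid : (1 / (K : ℝ)) * ∑ i, (u ⬝ᵥ score f (X i ω)) ^ 2 - q
      = q / K * ∑ i, (y (X i ω) - 1) := by
    simp only [hy, Finset.sum_sub_distrib, ← Finset.sum_div]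
    simp
    field_simp
  rw [hid, abs_mul, abs_of_pos (by positivity)] at hω
  have : K * ε = K / q * (ε * q) := by field_simp
  calc K * ε = K / q * (ε * q) := this
    _ < K / q * (q / K * |∑ i, (y (X i ω) - 1)|) := by gcongr
    _ = |∑ i, (y (X i ω) - 1)| := by field_simp

/-- The numerical content of the union bound over `5 ^ r` directions. The constant is
`65536 = 2 * 32 ^ 2 * (8 * 2 ^ 2)`: the tail exponent is then at least `2 (r + log (2 / η))`, and
`5 ≤ exp 2`. -/
theorem union_bound_le {r K : ℕ} {L δ η : ℝ} (hL : 0 < L) (hδ : 0 < δ) (hη0 : 0 < η) (hη1 : η < 1)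
    (hK : (K : ℝ) ≥ 65536 * Real.exp 1 ^ 2 * δ⁻¹ ^ 2 * L ^ 4 *
      (√(r : ℝ) + √(Real.log (2 * η⁻¹))) ^ 2) :
    (5 : ℝ) ^ r * (2 * Real.exp (-(K * (δ / 32) ^ 2 / (8 * (2 * Real.exp 1 * L ^ 2) ^ 2)))) ≤ η := by
  have hη : 1 < 2 * η⁻¹ := by
    have := (one_lt_inv₀ hη0).2 hη1
    linarith
  have hlog := Real.log_pos hη
  set l := Real.log (2 * η⁻¹) with hl
  have hsq : (r : ℝ) + l ≤ (√(r : ℝ) + √l) ^ 2 := by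
    rw [add_sq, Real.sq_sqrt (Nat.cast_nonneg r), Real.sq_sqrt hlog.le]
    have : 0 ≤ 2 * √(r : ℝ) * √l := by positivity
    linarith
  have hK' : 65536 * Real.exp 1 ^ 2 * δ⁻¹ ^ 2 * L ^ 4 * (r + l) ≤ K :=
    le_trans (by gcongr) hK
  have hexp : 2 * (r : ℝ) + l ≤ K * (δ / 32) ^ 2 / (8 * (2 * Real.exp 1 * L ^ 2) ^ 2) := by
    have : 65536 * Real.exp 1 ^ 2 * δ⁻¹ ^ 2 * L ^ 4 * (r + l) * (δ / 32) ^ 2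
        / (8 * (2 * Real.exp 1 * L ^ 2) ^ 2) = 2 * (r + l) := by
      field_simp
      ring
    calc 2 * (r : ℝ) + l ≤ 2 * (r + l) := by linarith
      _ = _ := this.symm
      _ ≤ _ := by gcongr
  have h5 : (5 : ℝ) ≤ Real.exp 2 := by
    have := Real.exp_one_gt_d9
    rw [show (2 : ℝ) = 1 + 1 by norm_num, Real.exp_add]
    nlinarith
  have h5r : (5 : ℝ) ^ r ≤ Real.exp (2 * r) := by
    rw [mul_comm, Real.exp_nat_mul]
    gcongr
  calc _ ≤ Real.exp (2 * r) * (2 * Real.exp (-(2 * r + l))) := by gcongr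
    _ = 2 * Real.exp (-l) := by
        rw [mul_left_comm, ← Real.exp_add]; ring_nf
    _ = η := by
        rw [Real.exp_neg, hl, Real.exp_log (by linarith)]
        field_simp

theorem mainTheorem3 :
    ∃ C : ℝ, 0 < C ∧
      ∀ (d : ℕ) (ν : Measure (EuclideanSpace ℝ (Fin d))) [IsProbabilityMeasure ν]
        (f : EuclideanSpace ℝ (Fin d) → ℝ)
        (_hf : ∀ᵐ x ∂ν, 0 < f x ∧ DifferentiableAt ℝ f x)
        (Γ : Matrix (Fin d) (Fin d) ℝ) (_hΓ : Γ.PosDef)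
        (L : ℝ) (_hL : 0 ≤ L)
        (_hsub : ∀ u : Fin d → ℝ,
          subGaussianNorm (fun x => u ⬝ᵥ score f x) ν
            ≤ ENNReal.ofReal (L * √(u ⬝ᵥ (scoreMatrix f ν *ᵥ u))))
        (δ η : ℝ) (_hδ0 : 0 < δ) (_hδ1 : δ < 1) (_hη0 : 0 < η) (_hη1 : η < 1)
        (K : ℕ) (_hK0 : 1 ≤ K)
        (_hK : (K : ℝ) ≥ C * δ⁻¹ ^ 2 * L ^ 4 *
          (√((scoreMatrix f ν).rank : ℝ) + √(Real.log (2 * η⁻¹))) ^ 2)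
        (S : Type*) [MeasurableSpace S] (Q : Measure S) [IsProbabilityMeasure Q]
        (X : Fin K → S → EuclideanSpace ℝ (Fin d))
        (_hlaw : ∀ i, HasLaw (X i) ν Q) (_hindep : iIndepFun X Q),
        ENNReal.ofReal (1 - η) ≤
          Q {ω | ∀ P : Matrix (Fin d) (Fin d) ℝ, IsIdempotentElem P →
            (1 - δ) * reconstructionError Γ P (scoreMatrix f ν)
                ≤ reconstructionError Γ P (monteCarloMatrix f (fun i => X i ω)) ∧
              reconstructionError Γ P (monteCarloMatrix f (fun i => X i ω))
                ≤ (1 + δ) * reconstructionError Γ P (scoreMatrix f ν)} := by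
  refine ⟨65536 * Real.exp 1 ^ 2, by positivity, ?_⟩
  intro d ν _ f _ Γ hΓ L hL hsub δ η hδ0 hδ1 hη0 hη1 K hK0 hK S _ Q _ X hlaw hindep
  have h2 : ∀ u : Fin d → ℝ, MemLp (fun x => u ⬝ᵥ score f x) 2 ν := fun u => by
    simpa using (moment_le_of_subGaussianNorm_le
      (measurable_dotProduct_score f u).aestronglyMeasurable (by positivity) (hsub u)
      (k := 2) (by norm_num)).1
  obtain ⟨N, Z, hNcard, hNpos, hZ, htest⟩ :=
    exists_finset_test_directions (scoreMatrix_posSemidef h2)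
  set H := scoreMatrix f ν
  -- The factor `1 / 32` is the loss in passing from the net to all directions.
  let bad : (Fin d → ℝ) → Set S := fun u => {ω | δ / 32 * (u ⬝ᵥ (H *ᵥ u))
    < |u ⬝ᵥ (monteCarloMatrix f (fun i => X i ω) *ᵥ u) - u ⬝ᵥ (H *ᵥ u)|}
  let null : Set S := {ω | ¬ ∀ z ∈ Z, monteCarloMatrix f (fun i => X i ω) *ᵥ z = 0}
  have hnull : Q null = 0 := by
    have : ∀ᵐ ω ∂Q, ∀ z ∈ Z, monteCarloMatrix f (fun i => X i ω) *ᵥ z = 0 :=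
      (Filter.eventually_all_finset Z).2 fun z hz =>
        ae_monteCarloMatrix_mulVec_eq_zero h2 hlaw (hZ z hz)
    exact this
  have hbad : Q.real (⋃ u ∈ N, bad u) ≤ η := by
    -- With no direction to test, `L` may vanish and there is nothing to bound.
    rcases N.eq_empty_or_nonempty with rfl | ⟨u₀, hu₀⟩
    · simpa using hη0.le
    have hdir := fun u (hu : u ∈ N) => measure_lt_abs_monteCarloMatrix_sub_le hL hsub h2 hK0 hlaw
      hindep (hNpos u hu) (ε := δ / 32) (by positivity) (by linarith)
    refine (measureReal_biUnion_finset_le N bad).trans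
      ((Finset.sum_le_card_nsmul N _ _ fun u hu => (hdir u hu).2).trans ?_)
    rw [nsmul_eq_mul]
    refine le_trans ?_ (union_bound_le (hdir u₀ hu₀).1 hδ0 hη0 hη1 hK)
    gcongr
    exact_mod_cast hNcard
  set good := {ω | ∀ P : Matrix (Fin d) (Fin d) ℝ, IsIdempotentElem P →
            (1 - δ) * reconstructionError Γ P H
                ≤ reconstructionError Γ P (monteCarloMatrix f (fun i => X i ω)) ∧
              reconstructionError Γ P (monteCarloMatrix f (fun i => X i ω))
                ≤ (1 + δ) * reconstructionError Γ P H}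
  have hcover : (Set.univ : Set S) ⊆ good ∪ ((⋃ u ∈ N, bad u) ∪ null) := by
    intro ω _
    by_contra hω
    simp only [Set.mem_union, not_or, Set.mem_iUnion, not_exists] at hω
    obtain ⟨hg, hb, hn⟩ := hω
    refine hg fun P _ => reconstructionError_bounds_of_abs_le hΓ (fun u => ?_) P
    have := htest _ (monteCarloMatrix_transpose f _) (not_not.1 hn) (δ / 32)
      (fun u hu => not_lt.1 (hb u hu)) u
    linarith
  have h1 : (1 : ℝ≥0∞) ≤ Q good + ENNReal.ofReal η := by
    calc (1 : ℝ≥0∞) = Q Set.univ := measure_univ.symm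
      _ ≤ Q good + (Q (⋃ u ∈ N, bad u) + Q null) :=
          (measure_mono hcover).trans ((measure_union_le _ _).trans
            (by gcongr; exact measure_union_le _ _))
      _ ≤ Q good + ENNReal.ofReal η := by
          rw [hnull, add_zero]
          gcongr
          rw [← ofReal_measureReal (measure_ne_top _ _)]
          exact ENNReal.ofReal_le_ofReal hbad
  rw [ENNReal.ofReal_sub _ hη0.le, ENNReal.ofReal_one]
  exact tsub_le_iff_right.2 h1
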